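/- Let $X$ and $V$ be Banach spaces over the same field ($\mathbb{R}$ or $\mathbb{C}$) such that $V$ embeds continuously into $X$ (so $V$ is regarded as a subspace of $X$ via an injective bounded linear map). Let $(T(t))_{t\ge 0}$ be a $C_0$-semigroup on $X$ with generator $A$, and suppose that there exist $C\ge 1$ and $\alpha>0$ such that \[ T(t)X\subseteq V \quad\text{and}\quad \|T(t)\|_{X\to V}\le C t^{-\alpha}\qquad\text{for all } t\in(0,1], \] i.e. $(T(t))_{t\ge 0}$ is ultracontractive with respect to $V$, and moreover $\|T(t)\|_{V\to V}\le C$ for all $t\in(0,1]$. Let $B:X\to X$ be a bounded linear operator with $BV\subseteq V$. Then $A+B$, with domain $\operatorname{dom}(A+B)=\operatorname{dom}(A)$, generates a $C_0$-semigroup $(S(t))_{t\ge 0}$ on $X$, and this semigroup is also ultracontractive with respect to $V$, with the same exponent: there exists $\widetilde C\ge 1$ such that \[ S(t)X\subseteq V \quad\text{and}\quad \|S(t)\|_{X\to V}\le \widetilde C t^{-\alpha}\qquad\text{for all } t\in(0,1]. \] -/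

import Mathlib

open Filter Topology
open scoped NNReal

/-- A `C₀`-semigroup of bounded linear operators on a normed space `X`. -/
structure C0Semigroup (𝕜 X : Type*) [RCLike 𝕜] [NormedAddCommGroup X] [NormedSpace 𝕜 X] where
  /-- The operator `T(t)`, `t ≥ 0`. -/
  op : ℝ≥0 → X →L[𝕜] X
  op_zero : op 0 = ContinuousLinearMap.id 𝕜 X
  op_add : ∀ s t : ℝ≥0, op (s + t) = (op s).comp (op t)
  continuous_orbit : ∀ x : X, Continuous fun t : ℝ≥0 => op t x

namespace C0Semigroup

variable {𝕜 X : Type*} [RCLike 𝕜] [NormedAddCommGroup X] [NormedSpace 𝕜 X]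

/-- `y = lim_{h ↓ 0} (T(h) x - x) / h`. -/
def HasGeneratorAt (T : C0Semigroup 𝕜 X) (x y : X) : Prop :=
  Tendsto (fun h : ℝ≥0 => (((h : ℝ) : 𝕜))⁻¹ • (T.op h x - x)) (𝓝[>] 0) (𝓝 y)

theorem HasGeneratorAt.unique {T : C0Semigroup 𝕜 X} {x y z : X}
    (hy : T.HasGeneratorAt x y) (hz : T.HasGeneratorAt x z) : y = z :=
  tendsto_nhds_unique hy hz

theorem HasGeneratorAt.zero (T : C0Semigroup 𝕜 X) : T.HasGeneratorAt 0 0 := by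
  simp [HasGeneratorAt]

theorem HasGeneratorAt.add {T : C0Semigroup 𝕜 X} {x x' y y' : X}
    (h : T.HasGeneratorAt x y) (h' : T.HasGeneratorAt x' y') :
    T.HasGeneratorAt (x + x') (y + y') := by
  refine (Tendsto.add h h').congr fun t => ?_
  rw [← smul_add, map_add]
  congr 1
  abel

theorem HasGeneratorAt.smul {T : C0Semigroup 𝕜 X} {x y : X} (c : 𝕜)
    (h : T.HasGeneratorAt x y) : T.HasGeneratorAt (c • x) (c • y) := by
  refine (Tendsto.const_smul h c).congr fun t => ?_
  rw [smul_comm, smul_sub, map_smul]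

/-- The generator of a `C₀`-semigroup: the operator `A x = lim_{h ↓ 0} (T(h) x - x) / h`, whose
domain is the set of all `x` for which the limit exists in `X`. -/
noncomputable def generator (T : C0Semigroup 𝕜 X) : X →ₗ.[𝕜] X where
  domain :=
    { carrier := {x | ∃ y, T.HasGeneratorAt x y}
      add_mem' := fun ⟨_, h⟩ ⟨_, h'⟩ => ⟨_, h.add h'⟩
      zero_mem' := ⟨0, HasGeneratorAt.zero T⟩
      smul_mem' := fun c _ ⟨_, h⟩ => ⟨_, h.smul c⟩ }
  toFun :=
    { toFun := fun x => Classical.choose x.2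
      map_add' := fun x y => (Classical.choose_spec (x + y).2).unique
        ((Classical.choose_spec x.2).add (Classical.choose_spec y.2))
      map_smul' := fun c x => (Classical.choose_spec (c • x).2).unique
        ((Classical.choose_spec x.2).smul c) }

theorem hasGeneratorAt_generator (T : C0Semigroup 𝕜 X) (x : T.generator.domain) :
    T.HasGeneratorAt x (T.generator x) :=
  Classical.choose_spec x.2

end C0Semigroup

section Embedding

variable {𝕜 E V X : Type*} [RCLike 𝕜] [NormedAddCommGroup E] [NormedSpace 𝕜 E]
  [NormedAddCommGroup V] [NormedSpace 𝕜 V] [NormedAddCommGroup X] [NormedSpace 𝕜 X]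

/-- For a space `V` regarded as a subspace of `X` through the injective map `ι`, the operator
`Q : E → X` maps into `V` and its operator norm satisfies `‖Q‖_{E → V} ≤ K`. -/
def NormIntoLE (ι : V →L[𝕜] X) (Q : E →L[𝕜] X) (K : ℝ) : Prop :=
  Set.range Q ⊆ Set.range ι ∧ ∀ (e : E) (v : V), ι v = Q e → ‖v‖ ≤ K * ‖e‖

/-- `T(t) X ⊆ V` and `‖T(t)‖_{X → V} ≤ C t^{-α}` for all `t ∈ (0, 1]`. -/
def C0Semigroup.UltracontractiveWith (T : C0Semigroup 𝕜 X) (ι : V →L[𝕜] X) (C α : ℝ) : Prop :=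
  ∀ t : ℝ≥0, 0 < t → t ≤ 1 → NormIntoLE ι (T.op t) (C * (t : ℝ) ^ (-α))

/-- `T(t) V ⊆ V` and `‖T(t)‖_{V → V} ≤ C` for all `t ∈ (0, 1]`. -/
def C0Semigroup.BoundedOnWith (T : C0Semigroup 𝕜 X) (ι : V →L[𝕜] X) (C : ℝ) : Prop :=
  ∀ t : ℝ≥0, 0 < t → t ≤ 1 → NormIntoLE ι ((T.op t).comp ι) C

/-- The operator `B` on `X` leaves the subspace `V` invariant. -/
def LeavesInvariant (B : X →L[𝕜] X) (ι : V →L[𝕜] X) : Prop :=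
  ∀ v : V, B (ι v) ∈ Set.range ι

end Embedding

/-!
The perturbed semigroup is the sum of the Dyson–Phillips series, whose terms are the iterates of
the Volterra operator `v ↦ ∫₀ᵗ T(t - s) B v(s) ds` on an orbit of `T`. To bound these terms in
`V`, split the integral at `t / 2`: for `s ≤ t / 2` use the smoothing `X → V` of `T(t - s)`, for
`s ≥ t / 2` use that `T(t - s)` and `B` are bounded on `V`, together with the `V`-norm of the
previous term at `s`. Both cost only `(t / 2) ^ (-α)`, so by induction the `n`-th term has
`V`-norm at most `K * t ^ (-α) * (L * t) ^ n / n! * ‖x‖`, which is summable over `n`. The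
`V`-valued integrals are Bochner integrals because `T(r) = T(ε) T(r - ε)` with `T(ε) : X → V`
makes the integrand continuous in `V`. Since a `C₀`-semigroup is determined by its generator, the
estimate holds for every semigroup generated by `A + B`.
-/

section StrongContinuity

variable {𝕜 E F Y : Type*} [NontriviallyNormedField 𝕜] [NormedAddCommGroup E] [NormedSpace 𝕜 E]
  [CompleteSpace E] [NormedAddCommGroup F] [NormedSpace 𝕜 F] [TopologicalSpace Y]
  {U : Y → E →L[𝕜] F}

theorem exists_opNorm_le_of_isCompact (hU : ∀ x, Continuous fun y => U y x) {K : Set Y}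
    (hK : IsCompact K) : ∃ M, ∀ y ∈ K, ‖U y‖ ≤ M := by
  have hpointwise (x : E) : ∃ M, ∀ y : K, ‖U y x‖ ≤ M := by
    obtain ⟨M, hM⟩ := hK.exists_bound_of_continuousOn (hU x).continuousOn
    exact ⟨M, fun y => hM y y.2⟩
  obtain ⟨M, hM⟩ := banach_steinhaus (g := fun y : K => U y) hpointwise
  exact ⟨M, fun y hy => hM ⟨y, hy⟩⟩

theorem continuous_uncurry_of_strongly_continuous [WeaklyLocallyCompactSpace Y]
    (hU : ∀ x, Continuous fun y => U y x) : Continuous fun p : Y × E => U p.1 p.2 := by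
  rw [continuous_iff_continuousAt]
  rintro ⟨y₀, x₀⟩
  obtain ⟨K, hK, hKy₀⟩ := exists_compact_mem_nhds y₀
  obtain ⟨M, hM⟩ := exists_opNorm_le_of_isCompact hU hK
  have hvector : Tendsto (fun p : Y × E => U p.1 (p.2 - x₀)) (𝓝 (y₀, x₀)) (𝓝 0) := by
    refine squeeze_zero_norm' (a := fun p : Y × E => M * ‖p.2 - x₀‖) ?_ ?_
    · filter_upwards [continuousAt_fst hKy₀] with p hp
      exact (U p.1).le_of_opNorm_le (hM _ hp) _
    · have : Continuous fun p : Y × E => M * ‖p.2 - x₀‖ := by fun_prop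
      simpa using this.tendsto (y₀, x₀)
  have hoperator : Tendsto (fun p : Y × E => U p.1 x₀) (𝓝 (y₀, x₀)) (𝓝 (U y₀ x₀)) :=
    ((hU x₀).comp continuous_fst).tendsto (y₀, x₀)
  simpa [ContinuousAt] using hvector.add hoperator

end StrongContinuity

section Calculus

theorem integral_mul_pow_div_factorial (L t : ℝ) (n : ℕ) :
    ∫ s in (0 : ℝ)..t, L * ((L * s) ^ n / n.factorial) = (L * t) ^ (n + 1) / (n + 1).factorial := by
  simp only [mul_pow, mul_div_assoc, intervalIntegral.integral_const_mul,
    intervalIntegral.integral_div, integral_pow, Nat.factorial_succ]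
  push_cast
  field_simp
  ring

theorem hasSum_pow_div_factorial_exp (r : ℝ) :
    HasSum (fun n : ℕ => r ^ n / n.factorial) (Real.exp r) := by
  rw [Real.exp_eq_exp_ℝ]
  exact NormedSpace.expSeries_div_hasSum_exp r

theorem hasDerivAt_integral_of_continuous_uncurry {E : Type*} [NormedAddCommGroup E]
    [NormedSpace ℝ E] [CompleteSpace E] {f : ℝ → ℝ → E}
    (hf : Continuous fun p : ℝ × ℝ => f p.1 p.2) :
    HasDerivAt (fun h => ∫ s in (0 : ℝ)..h, f h s) (f 0 0) 0 := by
  have hcont : Continuous fun h : ℝ => ∫ r in (0 : ℝ)..1, f h (h * r) :=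
    intervalIntegral.continuous_parametric_intervalIntegral_of_continuous
      (f := fun h r => f h (h * r))
      (hf.comp (f := fun p : ℝ × ℝ => (p.1, p.1 * p.2)) (by fun_prop)) continuous_const
  rw [hasDerivAt_iff_tendsto_slope_zero]
  have hlim := (hcont.tendsto 0).mono_left (nhdsWithin_le_nhds (s := {0}ᶜ))
  simp only [zero_mul, intervalIntegral.integral_const, sub_zero, one_smul] at hlim
  refine hlim.congr' (eventually_mem_nhdsWithin.mono fun h hh => ?_)
  simpa using intervalIntegral.integral_comp_mul_left (a := 0) (b := 1) (f h) hh

end Calculus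

namespace C0Semigroup

section Flow

variable {𝕜 X : Type*} [RCLike 𝕜] [NormedAddCommGroup X] [NormedSpace 𝕜 X]

/-- The operator `T(t)` for real `t`, extended by the identity to negative times, so that orbits can
be integrated and differentiated as functions on `ℝ`. -/
noncomputable def flow (T : C0Semigroup 𝕜 X) (t : ℝ) : X →L[𝕜] X := T.op t.toNNReal

theorem flow_coe (T : C0Semigroup 𝕜 X) (t : ℝ≥0) : T.flow t = T.op t := by
  rw [flow, Real.toNNReal_coe]

theorem flow_zero (T : C0Semigroup 𝕜 X) (x : X) : T.flow 0 x = x := by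
  simp [flow, T.op_zero]

theorem flow_add (T : C0Semigroup 𝕜 X) {s t : ℝ} (hs : 0 ≤ s) (ht : 0 ≤ t) (x : X) :
    T.flow (s + t) x = T.flow s (T.flow t x) := by
  simp [flow, Real.toNNReal_add hs ht, T.op_add]

theorem flow_comm (T : C0Semigroup 𝕜 X) {s t : ℝ} (hs : 0 ≤ s) (ht : 0 ≤ t) (x : X) :
    T.flow s (T.flow t x) = T.flow t (T.flow s x) := by
  rw [← T.flow_add hs ht, ← T.flow_add ht hs, add_comm]

theorem continuous_flow (T : C0Semigroup 𝕜 X) (x : X) : Continuous fun t => T.flow t x :=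
  (T.continuous_orbit x).comp continuous_real_toNNReal

variable [CompleteSpace X]

theorem exists_norm_flow_le (T : C0Semigroup 𝕜 X) (R : ℝ) : ∃ M, ∀ t ≤ R, ‖T.flow t‖ ≤ M := by
  obtain ⟨M, hM⟩ := exists_opNorm_le_of_isCompact T.continuous_orbit
    (isCompact_Icc (a := 0) (b := R.toNNReal))
  exact ⟨M, fun t ht => hM _ ⟨zero_le, Real.toNNReal_le_toNNReal ht⟩⟩

theorem continuous_flow_apply (T : C0Semigroup 𝕜 X) {Y : Type*} [TopologicalSpace Y]
    {τ : Y → ℝ} {f : Y → X} (hτ : Continuous τ) (hf : Continuous f) :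
    Continuous fun y => T.flow (τ y) (f y) :=
  (continuous_uncurry_of_strongly_continuous T.continuous_flow).comp (hτ.prodMk hf)

theorem intervalIntegrable_flow_sub (T : C0Semigroup 𝕜 X) {f : ℝ → X} (hf : Continuous f)
    (t a b : ℝ) : IntervalIntegrable (fun s => T.flow (t - s) (f s)) MeasureTheory.volume a b :=
  (T.continuous_flow_apply (by fun_prop) hf).intervalIntegrable a b

end Flow

section Generator

variable {𝕜 X : Type*} [RCLike 𝕜] [NormedAddCommGroup X] [NormedSpace 𝕜 X]
  {S T : C0Semigroup 𝕜 X} {x y : X}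

theorem mem_graph_generator : (x, y) ∈ T.generator.graph ↔ T.HasGeneratorAt x y := by
  rw [LinearPMap.mem_graph_iff]
  constructor
  · rintro ⟨x', rfl, rfl⟩
    exact T.hasGeneratorAt_generator x'
  · exact fun h => ⟨⟨x, y, h⟩, rfl, (T.hasGeneratorAt_generator ⟨x, y, h⟩).unique h⟩

theorem generator_eq_vadd {B : X →L[𝕜] X}
    (h : ∀ x y, S.HasGeneratorAt x (B x + y) ↔ T.HasGeneratorAt x y) :
    S.generator = (B : X →ₗ[𝕜] X) +ᵥ T.generator := by
  refine LinearPMap.ext ?_ fun x hS hT => ?_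
  · ext x
    refine ⟨fun ⟨y, hy⟩ => ⟨y - B x, (h _ _).1 ?_⟩, fun ⟨y, hy⟩ => ⟨_, (h _ _).2 hy⟩⟩
    rwa [add_sub_cancel]
  · exact (S.hasGeneratorAt_generator ⟨x, hS⟩).unique
      ((h _ _).2 (T.hasGeneratorAt_generator ⟨x, hT⟩))

variable [NormedSpace ℝ X] [IsScalarTower ℝ 𝕜 X]

theorem hasGeneratorAt_iff_hasDerivWithinAt :
    T.HasGeneratorAt x y ↔ HasDerivWithinAt (fun t => T.flow t x) y (Set.Ioi 0) 0 := by
  rw [hasDerivWithinAt_iff_tendsto_slope' (by simp), ← NNReal.coe_zero, ← NNReal.map_coe_nhdsGT,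
    tendsto_map'_iff]
  refine tendsto_congr fun t => ?_
  simp [slope_def_module, flow_coe, flow_zero, RCLike.real_smul_eq_coe_smul (K := 𝕜)]

theorem HasGeneratorAt.flow (h : T.HasGeneratorAt x y) {s : ℝ} (hs : 0 ≤ s) :
    T.HasGeneratorAt (T.flow s x) (T.flow s y) := by
  rw [hasGeneratorAt_iff_hasDerivWithinAt] at h ⊢
  refine (((T.flow s).restrictScalars ℝ).hasFDerivAt.comp_hasDerivWithinAt 0 h).congr
    (fun t ht => T.flow_comm (le_of_lt ht) hs x) (T.flow_comm le_rfl hs x)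

variable [CompleteSpace X]

theorem hasGeneratorAt_integral (T : C0Semigroup 𝕜 X) (x : X) {r : ℝ} (hr : 0 ≤ r) :
    T.HasGeneratorAt (∫ s in (0 : ℝ)..r, T.flow s x) (T.flow r x - x) := by
  set F : ℝ → X := fun t => ∫ s in (0 : ℝ)..t, T.flow s x
  have hint (a b : ℝ) : IntervalIntegrable (fun s => T.flow s x) MeasureTheory.volume a b :=
    (T.continuous_flow x).intervalIntegrable a b
  have hF (t : ℝ) : HasDerivAt F (T.flow t x) t :=
    ((T.continuous_flow x).integral_hasStrictDerivAt 0 t).hasDerivAt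
  have hflow (h : ℝ) (hh : 0 ≤ h) : T.flow h (F r) = F (h + r) - F h :=
    calc T.flow h (F r) = ∫ s in (0 : ℝ)..r, T.flow (h + s) x := by
          rw [← ContinuousLinearMap.intervalIntegral_comp_comm _ (hint 0 r)]
          refine intervalIntegral.integral_congr fun s hs => (T.flow_add hh ?_ x).symm
          exact (Set.uIcc_of_le hr ▸ hs).1
      _ = ∫ s in h..h + r, T.flow s x := by
          simpa using intervalIntegral.integral_comp_add_left (a := 0) (b := r)
            (fun s => T.flow s x) h
      _ = F (h + r) - F h :=
          (intervalIntegral.integral_interval_sub_left (hint _ _) (hint _ _)).symm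
  rw [hasGeneratorAt_iff_hasDerivWithinAt]
  have hderiv := ((hF (0 + r)).comp_add_const 0 r).sub (hF 0)
  rw [zero_add, T.flow_zero] at hderiv
  exact hderiv.hasDerivWithinAt.congr (fun h hh => hflow h (le_of_lt hh)) (hflow 0 le_rfl)

theorem dense_hasGeneratorAt (T : C0Semigroup 𝕜 X) : Dense {x | ∃ y, T.HasGeneratorAt x y} := by
  intro x
  have hderiv := ((T.continuous_flow x).integral_hasStrictDerivAt 0 0).hasDerivAt
  have hlim := hderiv.tendsto_slope_zero_right
  simp only [zero_add, intervalIntegral.integral_same, sub_zero, T.flow_zero] at hlim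
  refine mem_closure_of_tendsto hlim (eventually_mem_nhdsWithin.mono fun h hh => ?_)
  rw [RCLike.real_smul_eq_coe_smul (K := 𝕜)]
  exact ⟨_, (T.hasGeneratorAt_integral x (le_of_lt hh)).smul _⟩

theorem hasDerivWithinAt_flow_sub_flow {s t : ℝ} (hs : 0 ≤ s) (hst : s < t)
    (hS : S.HasGeneratorAt (T.flow s x) y) (hT : T.HasGeneratorAt (T.flow s x) y) :
    HasDerivWithinAt (fun r => S.flow (t - r) (T.flow r x)) 0 (Set.Ioi s) s := by
  set D : ℝ → X := fun h => T.flow h (T.flow s x) - S.flow h (T.flow s x) with hD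
  have hD0 : D =o[𝓝[>] 0] fun h => h := by
    rw [hasGeneratorAt_iff_hasDerivWithinAt] at hS hT
    simpa [D, hasDerivWithinAt_iff_isLittleO, flow_zero] using hT.sub hS
  have hshift : Tendsto (fun r => r - s) (𝓝[>] s) (𝓝[>] 0) := by
    refine tendsto_nhdsWithin_iff.2 ⟨?_, eventually_mem_nhdsWithin.mono fun r hr =>
      Set.mem_Ioi.2 (sub_pos.2 hr)⟩
    simpa using ((continuous_sub_right s).tendsto s).mono_left nhdsWithin_le_nhds
  obtain ⟨M, hM⟩ := S.exists_norm_flow_le t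
  have hfactor : ∀ r ∈ Set.Ioo s t, S.flow (t - r) (T.flow r x) - S.flow (t - s) (T.flow s x) =
      S.flow (t - r) (D (r - s)) := by
    intro r ⟨hsr, hrt⟩
    have hTr : T.flow r x = T.flow (r - s) (T.flow s x) := by
      rw [← T.flow_add (sub_nonneg.2 hsr.le) hs, sub_add_cancel]
    have hSs : S.flow (t - s) (T.flow s x) = S.flow (t - r) (S.flow (r - s) (T.flow s x)) := by
      rw [← S.flow_add (sub_nonneg.2 hrt.le) (sub_nonneg.2 hsr.le), sub_add_sub_cancel]
    rw [hTr, hSs, hD, map_sub]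
  rw [hasDerivWithinAt_iff_isLittleO]
  simp only [smul_zero, sub_zero]
  refine (Asymptotics.IsBigO.of_bound M ?_).trans_isLittleO (hD0.comp_tendsto hshift)
  filter_upwards [Ioo_mem_nhdsGT hst] with r hr
  rw [hfactor r hr]
  exact (S.flow (t - r)).le_of_opNorm_le (hM _ (by linarith [hr.1])) _

theorem flow_eq_of_hasGeneratorAt_imp (h : ∀ x y, T.HasGeneratorAt x y → S.HasGeneratorAt x y)
    (hx : T.HasGeneratorAt x y) {t : ℝ} (ht : 0 ≤ t) : S.flow t x = T.flow t x := by
  have hcont : Continuous fun s => S.flow (t - s) (T.flow s x) :=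
    S.continuous_flow_apply (by fun_prop) (T.continuous_flow x)
  have hconst := constant_of_has_deriv_right_zero hcont.continuousOn (fun s hs =>
    have hs' := hx.flow hs.1
    (hasDerivWithinAt_flow_sub_flow hs.1 hs.2 (h _ _ hs') hs').Ici_of_Ioi) t ⟨ht, le_rfl⟩
  simpa [flow_zero] using hconst.symm

theorem eq_of_generator_eq (h : S.generator = T.generator) : S = T := by
  have himp (x y : X) (hxy : T.HasGeneratorAt x y) : S.HasGeneratorAt x y := by
    rwa [← mem_graph_generator, h, mem_graph_generator]
  have hop : S.op = T.op := by
    funext t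
    refine ContinuousLinearMap.coeFn_injective
      ((S.op t).continuous.ext_on T.dense_hasGeneratorAt (T.op t).continuous ?_)
    rintro x ⟨y, hy⟩
    simpa only [flow_coe] using flow_eq_of_hasGeneratorAt_imp himp hy t.coe_nonneg
  cases S
  cases T
  congr

end Generator

section Volterra

variable {𝕜 X : Type*} [RCLike 𝕜] [NormedAddCommGroup X] [NormedSpace 𝕜 X] [NormedSpace ℝ X]

/-- The Volterra operator `v ↦ (t ↦ ∫₀ᵗ T(t - s) B v(s) ds)`, whose Neumann series solves the
variation of constants formula. -/
noncomputable def volterra (T : C0Semigroup 𝕜 X) (B : X →L[𝕜] X) (v : ℝ → X) (t : ℝ) : X :=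
  ∫ s in (0 : ℝ)..t, T.flow (t - s) (B (v s))

/-- The terms of the Dyson–Phillips series at `x`: the iterates of the Volterra operator on the
orbit of `x`. -/
noncomputable def dysonTerm (T : C0Semigroup 𝕜 X) (B : X →L[𝕜] X) (x : X) : ℕ → ℝ → X
  | 0 => fun t => T.flow t x
  | n + 1 => T.volterra B (dysonTerm T B x n)

/-- The sum of the Dyson–Phillips series at `x`, extended by `x` to negative times so that it is
continuous on `ℝ`. -/
noncomputable def dysonSum (T : C0Semigroup 𝕜 X) (B : X →L[𝕜] X) (x : X) (t : ℝ) : X :=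
  ∑' n, T.dysonTerm B x n (max t 0)

/-- `u` is a mild solution of `u' = (A + B) u`, `u(0) = x`, where `A` is the generator of `T`: it is
continuous and satisfies the variation of constants formula for `t ≥ 0`. -/
structure IsMildSolution (T : C0Semigroup 𝕜 X) (B : X →L[𝕜] X) (x : X) (u : ℝ → X) : Prop where
  continuous : Continuous u
  eq : ∀ t, 0 ≤ t → u t = T.flow t x + T.volterra B u t

variable {T : C0Semigroup 𝕜 X} {B : X →L[𝕜] X} {x y : X} {u v w : ℝ → X}

theorem norm_volterra_le {M F L R : ℝ} (hM : ∀ t ≤ R, ‖T.flow t‖ ≤ M) (hL : M * ‖B‖ ≤ L) {n : ℕ}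
    (hv : ∀ s, 0 ≤ s → s ≤ R → ‖v s‖ ≤ F * ((L * s) ^ n / n.factorial)) {t : ℝ} (ht : 0 ≤ t)
    (htR : t ≤ R) : ‖T.volterra B v t‖ ≤ F * ((L * t) ^ (n + 1) / (n + 1).factorial) := by
  have hM0 : 0 ≤ M := (norm_nonneg _).trans (hM t htR)
  have hL0 : 0 ≤ L := (by positivity : 0 ≤ M * ‖B‖).trans hL
  have hintegrand : ∀ s ∈ Set.Ioc 0 t, ‖T.flow (t - s) (B (v s))‖ ≤
      F * (L * ((L * s) ^ n / n.factorial)) := by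
    intro s ⟨hs, hst⟩
    calc ‖T.flow (t - s) (B (v s))‖ ≤ M * (‖B‖ * ‖v s‖) :=
          (T.flow (t - s)).le_of_opNorm_le_of_le (hM _ (by linarith)) (B.le_opNorm _)
      _ = M * ‖B‖ * ‖v s‖ := by ring
      _ ≤ L * (F * ((L * s) ^ n / n.factorial)) := by gcongr; exact hv s hs.le (hst.trans htR)
      _ = F * (L * ((L * s) ^ n / n.factorial)) := by ring
  rw [← integral_mul_pow_div_factorial, ← intervalIntegral.integral_const_mul]
  exact intervalIntegral.norm_integral_le_of_norm_le ht (.of_forall hintegrand)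
    ((by fun_prop : Continuous _).intervalIntegrable _ _)

theorem norm_dysonTerm_le {M L R : ℝ} (hM : ∀ t ≤ R, ‖T.flow t‖ ≤ M) (hL : M * ‖B‖ ≤ L)
    (x : X) (n : ℕ) {t : ℝ} (ht : 0 ≤ t) (htR : t ≤ R) :
    ‖T.dysonTerm B x n t‖ ≤ M * ‖x‖ * ((L * t) ^ n / n.factorial) := by
  induction n generalizing t with
  | zero => simpa [dysonTerm] using (T.flow t).le_of_opNorm_le (hM t htR) x
  | succ n ih => exact norm_volterra_le hM hL (fun s hs hsR => ih hs hsR) ht htR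

theorem volterra_smul [SMulCommClass ℝ 𝕜 X] (c : 𝕜) (v : ℝ → X) (t : ℝ) :
    T.volterra B (fun s => c • v s) t = c • T.volterra B v t := by
  simp only [volterra, map_smul]
  exact intervalIntegral.integral_smul _ _

theorem volterra_congr {t : ℝ} (ht : 0 ≤ t) (h : ∀ s, 0 ≤ s → v s = w s) :
    T.volterra B v t = T.volterra B w t :=
  intervalIntegral.integral_congr fun s hs => by
    rw [Set.uIcc_of_le ht] at hs
    simp only [h s hs.1]

theorem IsMildSolution.apply_zero (hu : T.IsMildSolution B x u) : u 0 = x := by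
  simp [hu.eq 0 le_rfl, volterra, flow_zero]

theorem IsMildSolution.smul [SMulCommClass ℝ 𝕜 X] (c : 𝕜) (hu : T.IsMildSolution B x u) :
    T.IsMildSolution B (c • x) fun t => c • u t where
  continuous := hu.continuous.const_smul c
  eq t ht := by rw [volterra_smul, hu.eq t ht, map_smul, smul_add]

theorem IsMildSolution.congr (hu : T.IsMildSolution B x u) (hv : Continuous v)
    (h : ∀ t, 0 ≤ t → u t = v t) : T.IsMildSolution B x v where
  continuous := hv
  eq t ht := by rw [← h t ht, hu.eq t ht, volterra_congr ht h]

variable [CompleteSpace X]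

theorem continuous_volterra (hv : Continuous v) : Continuous (T.volterra B v) :=
  intervalIntegral.continuous_parametric_intervalIntegral_of_continuous
    (f := fun t s => T.flow (t - s) (B (v s)))
    (T.continuous_flow_apply (by fun_prop) (by fun_prop)) continuous_id

theorem hasDerivAt_volterra_zero (hv : Continuous v) :
    HasDerivAt (T.volterra B v) (B (v 0)) 0 := by
  have hcont : Continuous fun p : ℝ × ℝ => T.flow (p.1 - p.2) (B (v p.2)) :=
    T.continuous_flow_apply (by fun_prop) (by fun_prop)
  have h := hasDerivAt_integral_of_continuous_uncurry
    (f := fun t s => T.flow (t - s) (B (v s))) hcont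
  rwa [sub_zero, T.flow_zero] at h

theorem volterra_add (hv : Continuous v) (hw : Continuous w) (t : ℝ) :
    T.volterra B (fun s => v s + w s) t = T.volterra B v t + T.volterra B w t := by
  simp only [volterra, map_add]
  exact intervalIntegral.integral_add (T.intervalIntegrable_flow_sub (B.continuous.comp hv) t 0 t)
    (T.intervalIntegrable_flow_sub (B.continuous.comp hw) t 0 t)

theorem volterra_add_time (hv : Continuous v) {s t : ℝ} (hs : 0 ≤ s) (ht : 0 ≤ t) :
    T.volterra B v (t + s) =
      T.flow t (T.volterra B v s) + T.volterra B (fun r => v (r + s)) t := by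
  have hpast : ∫ r in (0 : ℝ)..s, T.flow (t + s - r) (B (v r)) = T.flow t (T.volterra B v s) := by
    rw [volterra, ← ContinuousLinearMap.intervalIntegral_comp_comm _
      (T.intervalIntegrable_flow_sub (by fun_prop : Continuous fun r => B (v r)) s 0 s)]
    refine intervalIntegral.integral_congr fun r hr => ?_
    rw [Set.uIcc_of_le hs] at hr
    rw [add_sub_assoc, T.flow_add ht (sub_nonneg.2 hr.2)]
  have hfuture : ∫ r in s..t + s, T.flow (t + s - r) (B (v r)) =
      T.volterra B (fun r => v (r + s)) t := by
    simpa [volterra] using (intervalIntegral.integral_comp_add_right (a := 0) (b := t)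
      (fun r => T.flow (t + s - r) (B (v r))) s).symm
  rw [← hpast, ← hfuture]
  exact (intervalIntegral.integral_add_adjacent_intervals
    (T.intervalIntegrable_flow_sub (B.continuous.comp hv) _ _ _)
    (T.intervalIntegrable_flow_sub (B.continuous.comp hv) _ _ _)).symm

theorem IsMildSolution.add (hu : T.IsMildSolution B x u) (hv : T.IsMildSolution B y v) :
    T.IsMildSolution B (x + y) fun t => u t + v t where
  continuous := hu.continuous.add hv.continuous
  eq t ht := by
    rw [volterra_add hu.continuous hv.continuous, hu.eq t ht, hv.eq t ht, map_add,
      add_add_add_comm]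

theorem IsMildSolution.shift (hu : T.IsMildSolution B x u) {s : ℝ} (hs : 0 ≤ s) :
    T.IsMildSolution B (u s) fun t => u (t + s) where
  continuous := hu.continuous.comp (by fun_prop)
  eq t ht := by
    rw [hu.eq _ (add_nonneg ht hs), volterra_add_time hu.continuous hs ht, T.flow_add ht hs,
      hu.eq s hs, map_add, add_assoc]

theorem IsMildSolution.eq_zero (hu : T.IsMildSolution B 0 u) {t : ℝ} (ht : 0 ≤ t) : u t = 0 := by
  obtain ⟨M, hM⟩ := T.exists_norm_flow_le t
  obtain ⟨F, hF⟩ := (isCompact_Icc (a := 0) (b := t)).exists_bound_of_continuousOn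
    hu.continuous.continuousOn
  have hbound (n : ℕ) : ∀ s, 0 ≤ s → s ≤ t → ‖u s‖ ≤ F * ((M * ‖B‖ * s) ^ n / n.factorial) := by
    induction n with
    | zero => intro s hs hst; simpa using hF s ⟨hs, hst⟩
    | succ n ih =>
      intro s hs hst
      rw [hu.eq s hs, map_zero, zero_add]
      exact norm_volterra_le hM le_rfl ih hs hst
  have hlim := (FloorSemiring.tendsto_pow_div_factorial_atTop (M * ‖B‖ * t)).const_mul F
  rw [mul_zero] at hlim
  exact norm_le_zero_iff.1 (ge_of_tendsto' hlim fun n => hbound n t ht le_rfl)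

theorem IsMildSolution.unique [SMulCommClass ℝ 𝕜 X] (hu : T.IsMildSolution B x u)
    (hv : T.IsMildSolution B x v) {t : ℝ} (ht : 0 ≤ t) : u t = v t := by
  have h := hu.add (hv.smul (-1))
  rw [neg_one_smul, add_neg_cancel] at h
  simpa [← sub_eq_add_neg, sub_eq_zero] using h.eq_zero ht

theorem continuous_dysonTerm (x : X) (n : ℕ) : Continuous (T.dysonTerm B x n) := by
  induction n with
  | zero => exact T.continuous_flow x
  | succ n ih => exact continuous_volterra ih

variable (T B)

theorem exists_summable_norm_dysonTerm_le (x : X) (R : ℝ) :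
    ∃ b : ℕ → ℝ, Summable b ∧ ∀ n t, 0 ≤ t → t ≤ R → ‖T.dysonTerm B x n t‖ ≤ b n := by
  obtain ⟨M, hM⟩ := T.exists_norm_flow_le R
  have hM0 : 0 ≤ M := (norm_nonneg _).trans (hM R le_rfl)
  refine ⟨fun n => M * ‖x‖ * ((M * ‖B‖ * R) ^ n / n.factorial),
    (Real.summable_pow_div_factorial _).mul_left _, fun n t ht htR => ?_⟩
  exact (norm_dysonTerm_le hM le_rfl x n ht htR).trans (by beta_reduce; gcongr)

theorem hasSum_dysonTerm (x : X) {t : ℝ} (ht : 0 ≤ t) :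
    HasSum (fun n => T.dysonTerm B x n t) (T.dysonSum B x t) := by
  obtain ⟨b, hb, hbound⟩ := T.exists_summable_norm_dysonTerm_le B x t
  rw [dysonSum, max_eq_left ht]
  exact (Summable.of_norm_bounded hb fun n => hbound n t ht le_rfl).hasSum

theorem continuous_dysonSum (x : X) : Continuous (T.dysonSum B x) := by
  refine continuous_iff_continuousAt.2 fun t => ?_
  obtain ⟨b, hb, hbound⟩ := T.exists_summable_norm_dysonTerm_le B x (max (t + 1) 0)
  have hcont : ContinuousOn (T.dysonSum B x) (Set.Iio (t + 1)) :=
    continuousOn_tsum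
      (fun n => ((continuous_dysonTerm x n).comp (by fun_prop)).continuousOn) hb
      fun n s hs => hbound n _ (le_max_right _ _) (max_le_max_right _ (le_of_lt hs))
  exact hcont.continuousAt (Iio_mem_nhds (lt_add_one t))

theorem hasSum_volterra_dysonTerm (x : X) {t : ℝ} (ht : 0 ≤ t) :
    HasSum (fun n => T.volterra B (T.dysonTerm B x n) t) (T.volterra B (T.dysonSum B x) t) := by
  obtain ⟨b, hb, hbound⟩ := T.exists_summable_norm_dysonTerm_le B x t
  obtain ⟨M, hM⟩ := T.exists_norm_flow_le t
  have hintegrand (n : ℕ) (s : ℝ) (hs : s ∈ Set.uIoc 0 t) :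
      ‖T.flow (t - s) (B (T.dysonTerm B x n s))‖ ≤ M * (‖B‖ * b n) := by
    rw [Set.uIoc_of_le ht] at hs
    exact (T.flow (t - s)).le_of_opNorm_le_of_le (hM _ (by linarith [hs.1]))
      (B.le_of_opNorm_le_of_le le_rfl (hbound n s hs.1.le hs.2))
  refine intervalIntegral.hasSum_integral_of_dominated_convergence (fun n _ => M * (‖B‖ * b n))
    (fun n => (T.intervalIntegrable_flow_sub
      (B.continuous.comp (continuous_dysonTerm x n)) t 0 t).aestronglyMeasurable_restrict_uIoc)
    (fun n => .of_forall (hintegrand n)) (.of_forall fun _ _ => (hb.mul_left _).mul_left _)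
    (by simp) (.of_forall fun s hs => ?_)
  rw [Set.uIoc_of_le ht] at hs
  exact ((T.flow (t - s)).comp B).hasSum (T.hasSum_dysonTerm B x hs.1.le)

theorem isMildSolution_dysonSum (x : X) : T.IsMildSolution B x (T.dysonSum B x) where
  continuous := T.continuous_dysonSum B x
  eq _ ht := (T.hasSum_dysonTerm B x ht).unique
    (HasSum.zero_add (T.hasSum_volterra_dysonTerm B x ht))

theorem exists_norm_dysonSum_le {t : ℝ} (ht : 0 ≤ t) :
    ∃ K, ∀ x, ‖T.dysonSum B x t‖ ≤ K * ‖x‖ := by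
  obtain ⟨M, hM⟩ := T.exists_norm_flow_le t
  have hexp := hasSum_pow_div_factorial_exp (M * ‖B‖ * t)
  refine ⟨M * Real.exp (M * ‖B‖ * t), fun x => ?_⟩
  rw [mul_right_comm]
  exact (T.hasSum_dysonTerm B x ht).norm_le_of_bounded (hexp.mul_left _)
    fun n => norm_dysonTerm_le hM le_rfl x n ht le_rfl

/-- The perturbed semigroup generated by `A + B`, where `A` is the generator of `T`, given by the
Dyson–Phillips series. -/
noncomputable def perturb [SMulCommClass ℝ 𝕜 X] : C0Semigroup 𝕜 X where
  op t := LinearMap.mkContinuousOfExistsBound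
    { toFun := fun x => T.dysonSum B x t
      map_add' := fun x y => (T.isMildSolution_dysonSum B (x + y)).unique
        ((T.isMildSolution_dysonSum B x).add (T.isMildSolution_dysonSum B y)) t.2
      map_smul' := fun c x => (T.isMildSolution_dysonSum B (c • x)).unique
        ((T.isMildSolution_dysonSum B x).smul c) t.2 }
    (T.exists_norm_dysonSum_le B t.2)
  op_zero := by
    ext x
    exact (T.isMildSolution_dysonSum B x).apply_zero
  op_add s t := by
    ext x
    exact ((T.isMildSolution_dysonSum B x).shift t.2).unique
      (T.isMildSolution_dysonSum B (T.dysonSum B x t)) s.2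
  continuous_orbit x := (T.continuous_dysonSum B x).comp NNReal.continuous_coe

theorem flow_perturb [SMulCommClass ℝ 𝕜 X] (x : X) {t : ℝ} (ht : 0 ≤ t) :
    (T.perturb B).flow t x = T.dysonSum B x t :=
  congrArg (T.dysonSum B x) (Real.coe_toNNReal t ht)

theorem isMildSolution_perturb [SMulCommClass ℝ 𝕜 X] (x : X) :
    T.IsMildSolution B x fun t => (T.perturb B).flow t x :=
  (T.isMildSolution_dysonSum B x).congr ((T.perturb B).continuous_flow x)
    fun _ ht => (T.flow_perturb B x ht).symm

variable {T B}

theorem hasGeneratorAt_add_iff [IsScalarTower ℝ 𝕜 X] {S : C0Semigroup 𝕜 X}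
    (hS : T.IsMildSolution B x fun t => S.flow t x) :
    S.HasGeneratorAt x (B x + y) ↔ T.HasGeneratorAt x y := by
  have hvolterra : HasDerivWithinAt (T.volterra B fun t => S.flow t x) (B x) (Set.Ioi 0) 0 := by
    simpa only [flow_zero] using (hasDerivAt_volterra_zero hS.continuous).hasDerivWithinAt
  rw [hasGeneratorAt_iff_hasDerivWithinAt, hasGeneratorAt_iff_hasDerivWithinAt]
  constructor
  · intro h
    refine (add_sub_cancel_left (B x) y ▸ h.sub hvolterra).congr (fun t ht => ?_) ?_
    · simp [hS.eq t (le_of_lt ht)]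
    · simp [hS.eq 0 le_rfl]
  · intro h
    refine (add_comm (B x) y ▸ h.add hvolterra).congr (fun t ht => ?_) ?_
    · simp [hS.eq t (le_of_lt ht)]
    · simp [hS.eq 0 le_rfl]

theorem generator_perturb [IsScalarTower ℝ 𝕜 X] (T : C0Semigroup 𝕜 X) (B : X →L[𝕜] X) :
    (T.perturb B).generator = (B : X →ₗ[𝕜] X) +ᵥ T.generator :=
  generator_eq_vadd fun x _ => hasGeneratorAt_add_iff (T.isMildSolution_perturb B x)

end Volterra

end C0Semigroup

section Subspace

variable {𝕜 E V X : Type*} [RCLike 𝕜] [NormedAddCommGroup E] [NormedSpace 𝕜 E]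
  [NormedAddCommGroup V] [NormedSpace 𝕜 V] [NormedAddCommGroup X] [NormedSpace 𝕜 X]
  {ι : V →L[𝕜] X}

/-- For a space `V` regarded as a subspace of `X` through `ι`, the vector `x` lies in `V` and
`‖x‖_V ≤ r`. -/
def MemWithNormLE (ι : V →L[𝕜] X) (x : X) (r : ℝ) : Prop :=
  ∃ v, ι v = x ∧ ‖v‖ ≤ r

theorem MemWithNormLE.mono {x : X} {r r' : ℝ} (h : MemWithNormLE ι x r) (hr : r ≤ r') :
    MemWithNormLE ι x r' :=
  h.imp fun _ hv => ⟨hv.1, hv.2.trans hr⟩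

theorem NormIntoLE.memWithNormLE {Q : E →L[𝕜] X} {K : ℝ} (hQ : NormIntoLE ι Q K) (e : E) :
    MemWithNormLE ι (Q e) (K * ‖e‖) := by
  obtain ⟨v, hv⟩ := hQ.1 ⟨e, rfl⟩
  exact ⟨v, hv, hQ.2 e v hv⟩

theorem NormIntoLE.of_memWithNormLE (hι : Function.Injective ι) {Q : E →L[𝕜] X} {K : ℝ}
    (hQ : ∀ e, MemWithNormLE ι (Q e) (K * ‖e‖)) : NormIntoLE ι Q K := by
  refine ⟨?_, fun e v hv => ?_⟩
  · rintro _ ⟨e, rfl⟩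
    exact (hQ e).imp fun _ hw => hw.1
  · obtain ⟨w, hw, hwK⟩ := hQ e
    rwa [hι (hv.trans hw.symm)]

theorem MemWithNormLE.map {Q : X →L[𝕜] X} {x : X} {K r : ℝ} (hx : MemWithNormLE ι x r)
    (hK : 0 ≤ K) (hQ : NormIntoLE ι (Q.comp ι) K) : MemWithNormLE ι (Q x) (K * r) := by
  obtain ⟨v, rfl, hv⟩ := hx
  exact (hQ.memWithNormLE v).mono (by gcongr)

theorem MemWithNormLE.hasSum [CompleteSpace V] {β : Type*} {f : β → X} {g : β → ℝ} {x : X} {r : ℝ}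
    (h : ∀ b, MemWithNormLE ι (f b) (g b)) (hf : HasSum f x) (hg : HasSum g r) :
    MemWithNormLE ι x r := by
  choose v hv hvg using h
  have hsum := (Summable.of_norm_bounded hg.summable hvg).hasSum
  refine ⟨∑' b, v b, HasSum.unique ?_ hf, hsum.norm_le_of_bounded hg hvg⟩
  simpa only [hv] using ι.hasSum hsum

theorem exists_linearMap_lift (hι : Function.Injective ι) {Q : E →L[𝕜] X}
    (hQ : ∀ e, Q e ∈ Set.range ι) : ∃ L : E →ₗ[𝕜] V, ∀ e, ι (L e) = Q e := by
  choose f hf using hQ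
  exact ⟨{ toFun := f
           map_add' := fun x y => hι (by simp [hf])
           map_smul' := fun c x => hι (by simp [hf]) }, hf⟩

theorem NormIntoLE.exists_lift (hι : Function.Injective ι) {Q : E →L[𝕜] X} {K : ℝ}
    (hQ : NormIntoLE ι Q K) : ∃ L : E →L[𝕜] V, ∀ e, ι (L e) = Q e := by
  obtain ⟨L, hL⟩ := exists_linearMap_lift hι fun e => hQ.1 ⟨e, rfl⟩
  exact ⟨L.mkContinuous K fun e => hQ.2 e _ (hL e), hL⟩

theorem exists_normIntoLE_of_range_subset [CompleteSpace E] [CompleteSpace V]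
    (hι : Function.Injective ι) {Q : E →L[𝕜] X} (hQ : Set.range Q ⊆ Set.range ι) :
    ∃ K, 0 ≤ K ∧ NormIntoLE ι Q K := by
  obtain ⟨L, hL⟩ := exists_linearMap_lift hι fun e => hQ ⟨e, rfl⟩
  have hcont : Continuous L := L.continuous_of_seq_closed_graph fun u x y hu hLu => by
    refine hι (tendsto_nhds_unique ((ι.continuous.tendsto y).comp hLu) ?_)
    simpa only [Function.comp_def, hL] using (Q.continuous.tendsto x).comp hu
  exact ⟨_, norm_nonneg _,
    .of_memWithNormLE hι fun e => ⟨L e, hL e, ContinuousLinearMap.le_opNorm ⟨L, hcont⟩ e⟩⟩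

end Subspace

namespace C0Semigroup

section Ultracontractive

variable {𝕜 V X : Type*} [RCLike 𝕜] [NormedAddCommGroup V] [NormedSpace 𝕜 V]
  [NormedAddCommGroup X] [NormedSpace 𝕜 X] {ι : V →L[𝕜] X} {T : C0Semigroup 𝕜 X} {B : X →L[𝕜] X}
  {C C₁ b α : ℝ}

theorem UltracontractiveWith.normIntoLE_flow (hT : T.UltracontractiveWith ι C α) {t : ℝ}
    (ht : 0 < t) (ht1 : t ≤ 1) : NormIntoLE ι (T.flow t) (C * t ^ (-α)) := by
  lift t to ℝ≥0 using ht.le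
  simpa only [flow_coe] using hT t ht ht1

theorem BoundedOnWith.normIntoLE_flow (hT : T.BoundedOnWith ι C) {t : ℝ} (ht : 0 < t)
    (ht1 : t ≤ 1) : NormIntoLE ι ((T.flow t).comp ι) C := by
  lift t to ℝ≥0 using ht.le
  simpa only [flow_coe] using hT t ht ht1

/-- Near a point, the orbit factors through a fixed operator `T(ε) : X → V`. -/
theorem UltracontractiveWith.continuousOn_lift [CompleteSpace X] (hι : Function.Injective ι)
    (hT : T.UltracontractiveWith ι C α) {Y : Type*} [TopologicalSpace Y] {A : Set Y} {τ : Y → ℝ}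
    {f : Y → X} {w : Y → V} (hτ : Continuous τ) (hf : Continuous f) (hpos : ∀ y ∈ A, 0 < τ y)
    (hw : ∀ y ∈ A, ι (w y) = T.flow (τ y) (f y)) : ContinuousOn w A := by
  intro y₀ hy₀
  obtain ⟨ε, hε, hε'⟩ := exists_between (lt_min (hpos y₀ hy₀) one_pos)
  obtain ⟨J, hJ⟩ := (hT.normIntoLE_flow hε (hε'.le.trans (min_le_right _ _))).exists_lift hι
  have hfactor : ∀ᶠ y in 𝓝[A] y₀, w y = J (T.flow (τ y - ε) (f y)) := by
    filter_upwards [eventually_mem_nhdsWithin, nhdsWithin_le_nhds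
      (hτ.continuousAt.eventually_const_lt (hε'.trans_le (min_le_left _ _)))] with y hyA hy
    refine hι ?_
    rw [hw y hyA, hJ, ← T.flow_add hε.le (sub_nonneg.2 hy.le), add_sub_cancel]
  have hcont : Continuous fun y => J (T.flow (τ y - ε) (f y)) :=
    J.continuous.comp (T.continuous_flow_apply (by fun_prop) hf)
  exact hcont.continuousWithinAt.congr_of_eventuallyEq hfactor (hfactor.self_of_nhdsWithin hy₀)

/-- For `s ≤ t / 2` the smoothing `X → V` of `T(t - s)` costs at most `(t / 2) ^ (-α)`; for
`s ≥ t / 2` the `V`-norm of `x` already does. -/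
theorem UltracontractiveWith.memWithNormLE_flow_sub (hT : T.UltracontractiveWith ι C α)
    (hTV : T.BoundedOnWith ι C₁) (hB : NormIntoLE ι (B.comp ι) b) (hC : 0 ≤ C) (hC₁ : 0 ≤ C₁)
    (hb : 0 ≤ b) (hα : 0 ≤ α) {s t r : ℝ} (hs : 0 < s) (hst : s < t) (ht : t ≤ 1) {x : X}
    (hx : ‖x‖ ≤ r) (hxV : MemWithNormLE ι x (s ^ (-α) * r)) :
    MemWithNormLE ι (T.flow (t - s) (B x))
      (2 ^ α * (C * ‖B‖ + C₁ * b) * t ^ (-α) * r) := by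
  have ht0 : 0 < t := hs.trans hst
  have hr : 0 ≤ r := (norm_nonneg x).trans hx
  have hts : 0 < t - s := sub_pos.2 hst
  have hhalf : 2 ^ α * t ^ (-α) = (t / 2) ^ (-α) := by
    rw [Real.div_rpow ht0.le zero_le_two, Real.rpow_neg zero_le_two, div_inv_eq_mul, mul_comm]
  have hle {σ : ℝ} (hσ : t / 2 ≤ σ) : σ ^ (-α) ≤ 2 ^ α * t ^ (-α) :=
    hhalf ▸ Real.rpow_le_rpow_of_nonpos (by positivity) hσ (neg_nonpos.2 hα)
  rcases le_total s (t / 2) with h | h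
  · refine ((hT.normIntoLE_flow hts (by linarith)).memWithNormLE (B x)).mono ?_
    calc C * (t - s) ^ (-α) * ‖B x‖ ≤ C * (2 ^ α * t ^ (-α)) * (‖B‖ * r) := by
          gcongr
          · exact hle (by linarith)
          · exact B.le_opNorm_of_le hx
      _ = 2 ^ α * (C * ‖B‖) * t ^ (-α) * r := by ring
      _ ≤ 2 ^ α * (C * ‖B‖ + C₁ * b) * t ^ (-α) * r := by
          gcongr
          exact le_add_of_nonneg_right (by positivity)
  · refine ((hxV.map hb hB).map hC₁ (hTV.normIntoLE_flow hts (by linarith))).mono ?_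
    calc C₁ * (b * (s ^ (-α) * r)) ≤ C₁ * (b * (2 ^ α * t ^ (-α) * r)) := by
          gcongr
          exact hle h
      _ = 2 ^ α * (C₁ * b) * t ^ (-α) * r := by ring
      _ ≤ 2 ^ α * (C * ‖B‖ + C₁ * b) * t ^ (-α) * r := by
          gcongr
          exact le_add_of_nonneg_left (by positivity)

variable [NormedSpace ℝ X] [CompleteSpace X] [NormedSpace ℝ V] [CompleteSpace V]

theorem UltracontractiveWith.memWithNormLE_volterra (hι : Function.Injective ι)
    (hT : T.UltracontractiveWith ι C α) {v : ℝ → X} (hv : Continuous v) {t : ℝ} (ht : 0 ≤ t)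
    {g : ℝ → ℝ} (hg : IntervalIntegrable g MeasureTheory.volume 0 t)
    (h : ∀ s ∈ Set.Ioo 0 t, MemWithNormLE ι (T.flow (t - s) (B (v s))) (g s)) :
    MemWithNormLE ι (T.volterra B v t) (∫ s in (0 : ℝ)..t, g s) := by
  choose! w hw hwg using h
  have hcont : ContinuousOn w (Set.Ioo 0 t) :=
    hT.continuousOn_lift hι (τ := fun s => t - s) (f := fun s => B (v s)) (by fun_prop)
      (by fun_prop) (fun s hs => sub_pos.2 hs.2) hw
  have hgIoo : MeasureTheory.IntegrableOn g (Set.Ioo 0 t) :=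
    ((intervalIntegrable_iff_integrableOn_Ioo_of_le ht).1 hg)
  have hbound : ∀ᵐ s ∂MeasureTheory.volume.restrict (Set.Ioo 0 t), ‖w s‖ ≤ g s :=
    MeasureTheory.ae_restrict_of_forall_mem measurableSet_Ioo hwg
  have hint : MeasureTheory.IntegrableOn w (Set.Ioo 0 t) :=
    hgIoo.mono' (hcont.aestronglyMeasurable measurableSet_Ioo) hbound
  refine ⟨∫ s in Set.Ioo 0 t, w s, ?_, ?_⟩
  · rw [← ContinuousLinearMap.integral_comp_comm _ hint, volterra,
      intervalIntegral.integral_of_le ht, MeasureTheory.integral_Ioc_eq_integral_Ioo]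
    exact MeasureTheory.setIntegral_congr_fun measurableSet_Ioo hw
  · rw [intervalIntegral.integral_of_le ht, MeasureTheory.integral_Ioc_eq_integral_Ioo]
    exact MeasureTheory.norm_integral_le_of_norm_le hgIoo hbound

theorem UltracontractiveWith.memWithNormLE_dysonTerm (hι : Function.Injective ι)
    (hT : T.UltracontractiveWith ι C α) (hTV : T.BoundedOnWith ι C₁)
    (hB : NormIntoLE ι (B.comp ι) b) (hC : 0 ≤ C) (hC₁ : 0 ≤ C₁) (hb : 0 ≤ b) (hα : 0 ≤ α)
    {K L : ℝ} (hCK : C ≤ K) (hK : ∀ t ≤ 1, ‖T.flow t‖ ≤ K) (hKL : K * ‖B‖ ≤ L)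
    (hL : 2 ^ α * (C * ‖B‖ + C₁ * b) ≤ L) (x : X) (n : ℕ) {t : ℝ} (ht : 0 < t) (ht1 : t ≤ 1) :
    MemWithNormLE ι (T.dysonTerm B x n t)
      (t ^ (-α) * (K * ‖x‖ * ((L * t) ^ n / n.factorial))) := by
  have hK0 : 0 ≤ K := hC.trans hCK
  have hL0 : 0 ≤ L := (by positivity : 0 ≤ K * ‖B‖).trans hKL
  induction n generalizing t with
  | zero =>
    refine ((hT.normIntoLE_flow ht ht1).memWithNormLE x).mono ?_
    simp only [pow_zero, Nat.factorial_zero, Nat.cast_one, div_one, mul_one]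
    rw [← mul_assoc, mul_comm (t ^ (-α))]
    gcongr
  | succ n ih =>
    set c := t ^ (-α) * (K * ‖x‖)
    have hintegrand : ∀ s ∈ Set.Ioo 0 t, MemWithNormLE ι (T.flow (t - s) (B (T.dysonTerm B x n s)))
        (c * (L * ((L * s) ^ n / n.factorial))) := by
      intro s ⟨hs, hst⟩
      have hs1 : s ≤ 1 := hst.le.trans ht1
      refine (hT.memWithNormLE_flow_sub hTV hB hC hC₁ hb hα hs hst ht1
        (norm_dysonTerm_le hK hKL x n hs.le hs1) (ih hs hs1)).mono ?_
      calc _ ≤ L * t ^ (-α) * (K * ‖x‖ * ((L * s) ^ n / n.factorial)) := by gcongr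
        _ = c * (L * ((L * s) ^ n / n.factorial)) := by ring
    have hvolterra := hT.memWithNormLE_volterra hι (continuous_dysonTerm x n) ht.le
      ((by fun_prop : Continuous _).intervalIntegrable 0 t) hintegrand
    rwa [intervalIntegral.integral_const_mul, integral_mul_pow_div_factorial, mul_assoc]
      at hvolterra

theorem UltracontractiveWith.perturb [SMulCommClass ℝ 𝕜 X] (hι : Function.Injective ι)
    (hT : T.UltracontractiveWith ι C α) (hTV : T.BoundedOnWith ι C₁) (hB : LeavesInvariant B ι)
    (hC : 0 ≤ C) (hC₁ : 0 ≤ C₁) (hα : 0 ≤ α) :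
    ∃ C', 1 ≤ C' ∧ (T.perturb B).UltracontractiveWith ι C' α := by
  obtain ⟨b, hb, hBb⟩ := exists_normIntoLE_of_range_subset hι
    (Q := B.comp ι) (Set.range_subset_iff.2 hB)
  obtain ⟨M, hM⟩ := T.exists_norm_flow_le 1
  set K := max 1 (max C M)
  set L := max (K * ‖B‖) (2 ^ α * (C * ‖B‖ + C₁ * b))
  have hK : 1 ≤ K := le_max_left _ _
  have hL : 0 ≤ L := le_max_of_le_left (by positivity)
  refine ⟨K * Real.exp L, one_le_mul_of_one_le_of_one_le hK (Real.one_le_exp hL),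
    fun t ht ht1 => .of_memWithNormLE hι fun x => ?_⟩
  have hterm (n : ℕ) := hT.memWithNormLE_dysonTerm hι hTV hBb hC hC₁ hb hα
    (le_max_of_le_right (le_max_left C M))
    (fun s hs => (hM s hs).trans (le_max_of_le_right (le_max_right C M)))
    (le_max_left (K * ‖B‖) _) (le_max_right (K * ‖B‖) _) x n ht ht1
  have hsum := T.hasSum_dysonTerm B x t.coe_nonneg
  rw [← flow_perturb T B x t.coe_nonneg, flow_coe] at hsum
  have hexp := ((hasSum_pow_div_factorial_exp (L * t)).mul_left (K * ‖x‖)).mul_left ((t : ℝ) ^ (-α))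
  refine (MemWithNormLE.hasSum hterm hsum hexp).mono ?_
  calc (t : ℝ) ^ (-α) * (K * ‖x‖ * Real.exp (L * t))
      ≤ (t : ℝ) ^ (-α) * (K * ‖x‖ * Real.exp L) := by
        gcongr
        exact mul_le_of_le_one_right hL ht1
    _ = K * Real.exp L * (t : ℝ) ^ (-α) * ‖x‖ := by ring

end Ultracontractive

end C0Semigroup

theorem theorem1p1 {𝕜 X V : Type*} [RCLike 𝕜]
    [NormedAddCommGroup X] [NormedSpace 𝕜 X] [CompleteSpace X]
    [NormedAddCommGroup V] [NormedSpace 𝕜 V] [CompleteSpace V]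
    (ι : V →L[𝕜] X) (hι : Function.Injective ι)
    (T : C0Semigroup 𝕜 X) (C α : ℝ) (hC : 1 ≤ C) (hα : 0 < α)
    (hT : T.UltracontractiveWith ι C α) (hTV : T.BoundedOnWith ι C)
    (B : X →L[𝕜] X) (hB : LeavesInvariant B ι) :
    -- `B +ᵥ A` is the operator `A + B` with domain `dom(A)`
    (∃ S : C0Semigroup 𝕜 X, S.generator = (B : X →ₗ[𝕜] X) +ᵥ T.generator) ∧
    ∀ S : C0Semigroup 𝕜 X, S.generator = (B : X →ₗ[𝕜] X) +ᵥ T.generator →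
      ∃ C' : ℝ, 1 ≤ C' ∧ S.UltracontractiveWith ι C' α := by
  let _ : NormedSpace ℝ X := NormedSpace.restrictScalars ℝ 𝕜 X
  let _ : NormedSpace ℝ V := NormedSpace.restrictScalars ℝ 𝕜 V
  have : IsScalarTower ℝ 𝕜 X := IsScalarTower.of_algebraMap_smul fun _ _ => rfl
  have hC₀ : 0 ≤ C := zero_le_one.trans hC
  refine ⟨⟨T.perturb B, T.generator_perturb B⟩, fun S hS => ?_⟩
  rw [C0Semigroup.eq_of_generator_eq (hS.trans (T.generator_perturb B).symm)]
  exact hT.perturb hι hTV hB hC₀ hC₀ hα.le
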